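/- Let $\Delta$ be a simplicial complex on a finite vertex set $V=\{v_1,\dots,v_n\}$ (so $\emptyset\in\Delta$ and $\{v_i\}\in\Delta$ for all $i$), with $\dim F=|F|-1$ for a face $F$. Its facets are its maximal faces; a subcomplex of $\Delta$ is a simplicial complex all of whose facets are facets of $\Delta$. A facet $F$ of a complex is a leaf if it is the only facet or if there is a facet $G\neq F$ with $F\cap H\subseteq F\cap G$ for all facets $H\neq F$. A chain between facets $F,G$ is a sequence of facets $F=F_0,\dots,F_r=G$ with $F_i\cap F_{i+1}\ne\emptyset$ for all $i<r$; it is proper if moreover $\dim(F_i\cap F_{i+1})=\dim F_{i+1}-1$ for all $i<r$. $\Delta$ is connected if any two facets are joined by a chain, and connected in codimension $1$ if for any two facets $F,G$ with $\dim F\ge\dim G$ there is a proper chain from $F$ to $G$. $\Delta$ is pure if all its facets have the same dimension. $\Delta$ is a tree if it is connected and every nonempty subcomplex of $\Delta$ has a leaf. Let $K$ be a field, $R=K[x_1,\dots,x_n]$, and let the facet ideal $I(\Delta)\subseteq R$ be the ideal generated by the monomials $\prod_{v_i\in F}x_i$, where $F$ runs over the facets of $\Delta$. A monomial ideal $I$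 with minimal set $G(I)$ of monomial generators is a linear quotient ideal if all elements of $G(I)$ have the same degree and, for some order $f_1,\dots,f_m$ of $G(I)$, the colon ideal $(f_1,\dots,f_{i-1}):f_i$ is generated by monomials of degree $1$ (possibly by none) for each $i=1,\dots,m$. A graded ideal $I$ has a linear resolution if, for some integer $q$, its minimal graded free resolution has the form $\cdots\to R(-q-2)^{b_2}\to R(-q-1)^{b_1}\to R(-q)^{b_0}\to I\to 0$. **Proposition.** Let $\Delta$ be a tree and $I=I(\Delta)$ its facet ideal. (i) $I$ is a linear quotient ideal if and only if $I$ has a linear resolution. (ii) If the equivalent conditions of (i) hold, then $\Delta$ is pure and connected in codimension $1$. -/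

import Mathlib

open MvPolynomial

namespace FacetComplex

section Complexes

variable {V : Type*}

/-- The faces of a simplicial complex in the convention where the empty set is always a face
(Mathlib only records the nonempty faces). The complexes on a subset of `V`, with the empty face,
correspond exactly to the terms of `PreAbstractSimplicialComplex V`; those for which every
`v : V` is a vertex correspond to the terms of `AbstractSimplicialComplex V`. -/
def IsFace (Γ : PreAbstractSimplicialComplex V) (F : Finset V) : Prop :=
  F = ∅ ∨ F ∈ Γ.faces

/-- The dimension of a face, `|F| - 1`; in particular `dim ∅ = -1`. -/
def dim (F : Finset V) : ℤ := (F.card : ℤ) - 1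

/-- A facet is a face that is maximal under inclusion. -/
def IsFacet (Γ : PreAbstractSimplicialComplex V) (F : Finset V) : Prop :=
  Maximal (IsFace Γ) F

/-- `Γ` is a subcomplex of `Δ` if every facet of `Γ` is a facet of `Δ`. -/
def IsSubcomplex (Γ Δ : PreAbstractSimplicialComplex V) : Prop :=
  ∀ F, IsFacet Γ F → IsFacet Δ F

/-- A complex is pure if all its facets have the same dimension. -/
def IsPure (Γ : PreAbstractSimplicialComplex V) : Prop :=
  ∀ F G, IsFacet Γ F → IsFacet Γ G → dim F = dim G

variable [DecidableEq V]

/-- `c 0, ..., c n` is a chain of length `n` of facets between `F` and `G`: consecutive members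
have nonempty intersection. -/
def IsChainBetween (Γ : PreAbstractSimplicialComplex V) (F G : Finset V) (n : ℕ)
    (c : ℕ → Finset V) : Prop :=
  c 0 = F ∧ c n = G ∧ (∀ i, i ≤ n → IsFacet Γ (c i)) ∧
    ∀ i, i < n → (c i ∩ c (i + 1)).Nonempty

/-- A chain is proper if `dim (c i ∩ c (i + 1)) = dim (c (i + 1)) - 1` for all `i < n`. -/
def IsProperChainBetween (Γ : PreAbstractSimplicialComplex V) (F G : Finset V) (n : ℕ)
    (c : ℕ → Finset V) : Prop :=
  IsChainBetween Γ F G n c ∧ ∀ i, i < n → dim (c i ∩ c (i + 1)) = dim (c (i + 1)) - 1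

/-- Any two facets are joined by a chain. -/
def IsConnected (Γ : PreAbstractSimplicialComplex V) : Prop :=
  ∀ F G, IsFacet Γ F → IsFacet Γ G → ∃ n c, IsChainBetween Γ F G n c

/-- Any two facets `F`, `G` with `dim F ≥ dim G` are joined by a proper chain from `F` to `G`. -/
def IsConnectedInCodimOne (Γ : PreAbstractSimplicialComplex V) : Prop :=
  ∀ F G, IsFacet Γ F → IsFacet Γ G → dim G ≤ dim F → ∃ n c, IsProperChainBetween Γ F G n c

/-- A leaf is a facet `F` which is the only facet, or for which there is a facet `G ≠ F` with
`F ∩ H ⊆ F ∩ G` for all facets `H ≠ F`. -/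
def IsLeaf (Γ : PreAbstractSimplicialComplex V) (F : Finset V) : Prop :=
  IsFacet Γ F ∧ ((∀ H, IsFacet Γ H → H = F) ∨
    ∃ G, IsFacet Γ G ∧ G ≠ F ∧ ∀ H, IsFacet Γ H → H ≠ F → F ∩ H ⊆ F ∩ G)

/-- A (simplicial) tree is a connected complex all of whose nonempty subcomplexes have a leaf.
Every `Γ` below contains the empty face, so it is nonempty as a collection of faces; the
subcomplexes of `Δ` ranged over are exactly those generated by the nonempty sets of facets of `Δ`,
when `V` is finite. -/
def IsTree (Δ : PreAbstractSimplicialComplex V) : Prop :=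
  IsConnected Δ ∧ ∀ Γ : PreAbstractSimplicialComplex V, IsSubcomplex Γ Δ → ∃ F, IsLeaf Γ F

end Complexes

section Ideals

variable {V : Type*} {K : Type*} [Field K]

/-- The facet ideal: generated by the square-free monomials `∏ v ∈ F, x_v`, `F` a facet. -/
noncomputable def facetIdeal (K : Type*) [Field K] (Δ : PreAbstractSimplicialComplex V) :
    Ideal (MvPolynomial V K) :=
  Ideal.span {p | ∃ F, IsFacet Δ F ∧ p = ∏ v ∈ F, X v}

/-- A monomial ideal is an ideal generated by a set of monomials. -/
def IsMonomialIdeal (I : Ideal (MvPolynomial V K)) : Prop :=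
  ∃ A : Set (V →₀ ℕ), I = Ideal.span ((fun a => monomial a (1 : K)) '' A)

/-- The (exponents of the) minimal monomial generators `G(I)` of a monomial ideal `I`: the
monomials of `I` which are minimal with respect to divisibility. -/
def minGens (I : Ideal (MvPolynomial V K)) : Set (V →₀ ℕ) :=
  {a | Minimal (fun b : V →₀ ℕ => monomial b (1 : K) ∈ I) a}

/-- The ideal `(f_0, ..., f_{i-1})`, where `f_j` is the monomial with exponent `a j`. -/
noncomputable def initialSegmentIdeal (K : Type*) [Field K] {m : ℕ} (a : Fin m → V →₀ ℕ) (i : Fin m) :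
    Ideal (MvPolynomial V K) :=
  Ideal.span {p | ∃ j : Fin m, j < i ∧ p = monomial (a j) 1}

/-- A monomial ideal `I` is a linear quotient ideal if, for some enumeration `f_0, ..., f_{m-1}`
(without repetition) of `G(I)`, all `f_i` have the same degree and every colon ideal
`(f_0, ..., f_{i-1}) : f_i` is generated by monomials of degree 1, i.e. by a set of variables. -/
def IsLinearQuotientIdeal (I : Ideal (MvPolynomial V K)) : Prop :=
  IsMonomialIdeal I ∧
    ∃ (m : ℕ) (a : Fin m → V →₀ ℕ),
      Function.Injective a ∧ Set.range a = minGens I ∧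
      (∀ i, ∃ S : Set V,
        (initialSegmentIdeal K a i).colon {monomial (a i) (1 : K)} =
          Ideal.span ((fun v => (X v : MvPolynomial V K)) '' S)) ∧
      ∀ i j, (a i).degree = (a j).degree

/-- A graded free resolution of the ideal `I` of `R = K[x_v : v ∈ V]` by finitely generated
graded free modules
`⋯ → F_2 → F_1 → F_0 → I → 0`, `F_i = ⨁ k, R(-shift i k)`, with homogeneous maps of degree `0`.
The entry of the map `F_{i+1} → F_i` from the `k`-th to the `j`-th summand is therefore homogeneous
of degree `shift (i+1) k - shift i j`, and zero if this number is negative. -/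
structure GradedFreeResolution (I : Ideal (MvPolynomial V K)) where
  /-- the index set of the basis of `F_i` -/
  ι : ℕ → Type
  finite : ∀ i, Finite (ι i)
  /-- the degrees of the basis elements of `F_i` -/
  shift : ∀ i, ι i → ℕ
  /-- the augmentation `F_0 → I ⊆ R` -/
  aug : (ι 0 →₀ MvPolynomial V K) →ₗ[MvPolynomial V K] MvPolynomial V K
  /-- the differentials `F_{i+1} → F_i` -/
  d : ∀ i, (ι (i + 1) →₀ MvPolynomial V K) →ₗ[MvPolynomial V K] (ι i →₀ MvPolynomial V K)
  aug_homogeneous : ∀ k, (aug (Finsupp.single k 1)).IsHomogeneous (shift 0 k)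
  d_homogeneous : ∀ i k j,
    (d i (Finsupp.single k 1) j).IsHomogeneous (shift (i + 1) k - shift i j)
  d_eq_zero : ∀ i k j, shift (i + 1) k < shift i j → d i (Finsupp.single k 1) j = 0
  range_aug : LinearMap.range aug = I
  exact_aug : Function.Exact (d 0) aug
  exact_d : ∀ i, Function.Exact (d (i + 1)) (d i)

/-- The resolution is minimal: `d (F_{i+1}) ⊆ 𝔪 F_i` for all `i`, where `𝔪` is generated by the
variables, i.e. all entries of the differentials have constant coefficient zero. -/
def GradedFreeResolution.IsMinimal {I : Ideal (MvPolynomial V K)} (P : GradedFreeResolution I) :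
    Prop :=
  ∀ i k j, constantCoeff (P.d i (Finsupp.single k 1) j) = 0

/-- `I` has a linear resolution: for some `q`, its minimal graded free resolution (which is unique
up to isomorphism) has the form `⋯ → R(-q-2)^{b_2} → R(-q-1)^{b_1} → R(-q)^{b_0} → I → 0`. -/
def HasLinearResolution (I : Ideal (MvPolynomial V K)) : Prop :=
  ∃ (q : ℕ) (P : GradedFreeResolution I), P.IsMinimal ∧ ∀ i k, P.shift i k = q + i

variable [DecidableEq V]

/-- A tree whose facet ideal is a linear quotient ideal. -/
def IsLinearQuotientTree (K : Type*) [Field K] (Δ : PreAbstractSimplicialComplex V) : Prop :=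
  IsTree Δ ∧ IsLinearQuotientIdeal (facetIdeal K Δ)

/-- A tree whose facet ideal has a linear resolution. -/
def IsLinearTree (K : Type*) [Field K] (Δ : PreAbstractSimplicialComplex V) : Prop :=
  IsTree Δ ∧ HasLinearResolution (facetIdeal K Δ)

end Ideals

end FacetComplex

namespace FacetComplex

/-! ### Iterated syzygies of sequences with linear colon ideals -/

section LinearQuotientSystems

variable {V : Type*} {K : Type*} [Field K]

/-! Linear quotients give a linear resolution for any monomial ideal in finitely many variables: the
syzygies of vectors of one degree whose colon ideals are generated by variables are spanned by
linear syzygies, and these, ordered lexicographically, again have colon ideals generated by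
variables (`smul_syzygy_mem_iff`). Iterating yields the resolution.

Conversely, linearity of the first syzygies forces any two minimal generators `a`, `b` to be joined,
among the generators dividing their lcm, by steps whose lcm has degree at most `q + 1`
(`reflTransGen_linearStep`). For a tree this suffices: a leaf `F` is not contained in the union of
two other facets, so deleting it destroys no such path, while a path ending at `F` supplies the
variables generating the last colon ideal. Placing leaves last, recursively, orders the generators
(`exists_linearQuotient_order`).

The same paths of facets, with repetitions removed, are proper chains, which gives purity and
connectedness in codimension one. -/

theorem homogeneousComponent_mul_of_isHomogeneous (c : MvPolynomial V K) {g : MvPolynomial V K}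
    {d : ℕ} (hg : g.IsHomogeneous d) (n : ℕ) :
    homogeneousComponent (n + d) (c * g) = homogeneousComponent n c * g := by
  conv_lhs => rw [← sum_homogeneousComponent c]
  rw [Finset.sum_mul, map_sum]
  have key : ∀ i, homogeneousComponent (n + d) (homogeneousComponent i c * g) =
      if i = n then homogeneousComponent n c * g else 0 := by
    intro i
    have h : homogeneousComponent i c * g ∈ homogeneousSubmodule V K (i + d) :=
      (homogeneousComponent_isHomogeneous i c).mul hg
    rw [homogeneousComponent_of_mem h]
    by_cases hi : i = n
    · subst hi; simp
    · rw [if_neg hi, if_neg (by omega)]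
  simp only [key]
  rw [Finset.sum_ite_eq']
  split_ifs with h
  · rfl
  · rw [homogeneousComponent_eq_zero _ _ (by simpa using h), zero_mul]

theorem linearCombination_coord {ι κ : Type*} [Fintype ι] {R : Type*} [CommRing R]
    (g : ι → κ →₀ R) (z : ι →₀ R) (k : κ) :
    Finsupp.linearCombination R g z k = ∑ j, z j * g j k := by
  rw [Finsupp.linearCombination_apply, Finsupp.sum_fintype _ _ (by simp), Finsupp.finsetSum_apply]
  simp

/-- Multiplying a monomial by `X v` creates no divisibility by a variable of `S`, as `v ∉ S`. -/
theorem X_mul_mem_span_X_image_iff {S : Set V} {v : V} (hv : v ∉ S) (p : MvPolynomial V K) :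
    p * X v ∈ Ideal.span ((X : V → MvPolynomial V K) '' S) ↔
      p ∈ Ideal.span ((X : V → MvPolynomial V K) '' S) := by
  refine ⟨fun h => ?_, fun h => Ideal.mul_mem_right _ _ h⟩
  rw [mem_ideal_span_X_image] at h ⊢
  intro m hm
  obtain ⟨i, hi, hne⟩ := h (m + Finsupp.single v 1) (by
    rw [mem_support_iff, coeff_mul_X]
    exact mem_support_iff.1 hm)
  refine ⟨i, hi, ?_⟩
  have : v ≠ i := fun h => hv (h ▸ hi)
  simpa [Finsupp.single_apply, this] using hne

/-- A finite sequence `g` of homogeneous vectors of the same degree in a free module such that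
the colon ideal of each vector with respect to its predecessors is generated by variables. -/
structure LinearQuotientSystem (V : Type*) (K : Type*) [Field K] where
  κ : Type
  ι : Type
  linearOrder : LinearOrder ι
  fintype : Fintype ι
  deg : ℕ
  g : ι → κ →₀ MvPolynomial V K
  homogeneous : ∀ i k, (g i k).IsHomogeneous deg
  /-- the number of variables generating the colon ideal of `g i` -/
  r : ι → ℕ
  /-- the variables generating the colon ideal of `g i` -/
  s : ∀ i, Fin (r i) → V
  s_injective : ∀ i, Function.Injective (s i)
  smul_mem_iff : ∀ i p, p • g i ∈ Submodule.span (MvPolynomial V K) (g '' Set.Iio i) ↔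
    p ∈ Ideal.span ((X : V → MvPolynomial V K) '' Set.range (s i))

namespace LinearQuotientSystem

attribute [instance] LinearQuotientSystem.linearOrder LinearQuotientSystem.fintype

variable (S : LinearQuotientSystem V K)

/-- The map from the free module on the index set given by the vectors `g`. -/
noncomputable def map : (S.ι →₀ MvPolynomial V K) →ₗ[MvPolynomial V K]
    (S.κ →₀ MvPolynomial V K) :=
  Finsupp.linearCombination _ S.g

/-- Since all `g j` have the same degree, any relation expressing a variable times `g i` through its
predecessors survives when its coefficients are replaced by their linear parts. -/
theorem exists_linear_syzygy (i : S.ι) (a : Fin (S.r i)) :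
    ∃ z : S.ι →₀ MvPolynomial V K, (∀ j, (z j).IsHomogeneous 1) ∧ (∀ j, i < j → z j = 0) ∧
      z i = X (S.s i a) ∧ S.map z = 0 := by
  classical
  have h : (X (S.s i a) : MvPolynomial V K) • S.g i ∈
      Submodule.span (MvPolynomial V K) (S.g '' Set.Iio i) :=
    (S.smul_mem_iff _ _).2 (Ideal.subset_span ⟨_, ⟨a, rfl⟩, rfl⟩)
  obtain ⟨l, hl, hlX⟩ := (Finsupp.mem_span_image_iff_linearCombination _).1 h
  have hl0 : ∀ j, i ≤ j → l j = 0 := fun j hj => by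
    by_contra hne
    exact absurd ((Finsupp.mem_supported _ _).1 hl (Finsupp.mem_support_iff.2 hne)) (not_lt.2 hj)
  let w : S.ι →₀ MvPolynomial V K := l.mapRange (homogeneousComponent 1) (map_zero _)
  have hw : ∀ j, w j = homogeneousComponent 1 (l j) := fun j => Finsupp.mapRange_apply
  have hw0 : ∀ j, i ≤ j → w j = 0 := fun j hj => by rw [hw, hl0 j hj, map_zero]
  refine ⟨Finsupp.single i (X (S.s i a)) - w, fun j => ?_, fun j hj => ?_, ?_, ?_⟩
  · rw [Finsupp.sub_apply, hw]
    refine IsHomogeneous.sub ?_ (homogeneousComponent_isHomogeneous _ _)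
    rw [Finsupp.single_apply]
    split_ifs
    · exact isHomogeneous_X _ _
    · exact isHomogeneous_zero _ _ _
  · rw [Finsupp.sub_apply, hw0 j hj.le, Finsupp.single_eq_of_ne hj.ne', sub_zero]
  · rw [Finsupp.sub_apply, hw0 i le_rfl, Finsupp.single_eq_same, sub_zero]
  · rw [map_sub, sub_eq_zero, map, Finsupp.linearCombination_single]
    ext1 k
    have h1 := congrArg (fun f => homogeneousComponent (1 + S.deg) (f k)) hlX
    simp only [linearCombination_coord, map_sum, Finsupp.smul_apply, smul_eq_mul,
      homogeneousComponent_mul_of_isHomogeneous _ (S.homogeneous _ k)] at h1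
    rw [linearCombination_coord, Finsupp.smul_apply, smul_eq_mul]
    simp only [hw, h1]
    rw [homogeneousComponent_eq_self (isHomogeneous_X _ _)]

/-- A chosen linear syzygy with leading coefficient the `a`-th variable of the colon ideal of
`g i`. -/
noncomputable def syzygy (x : Σ i, Fin (S.r i)) : S.ι →₀ MvPolynomial V K :=
  (S.exists_linear_syzygy x.1 x.2).choose

theorem syzygy_isHomogeneous (x j) : (S.syzygy x j).IsHomogeneous 1 :=
  (S.exists_linear_syzygy x.1 x.2).choose_spec.1 j

theorem syzygy_of_lt {x j} (h : x.1 < j) : S.syzygy x j = 0 :=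
  (S.exists_linear_syzygy x.1 x.2).choose_spec.2.1 j h

theorem syzygy_self (x) : S.syzygy x x.1 = X (S.s x.1 x.2) :=
  (S.exists_linear_syzygy x.1 x.2).choose_spec.2.2.1

theorem map_syzygy (x) : S.map (S.syzygy x) = 0 :=
  (S.exists_linear_syzygy x.1 x.2).choose_spec.2.2.2

/-- Division by leading terms: `z i` lies in the colon ideal of `g i`, so a combination `y` of the
chosen syzygies at `i` cancels it, and `z - y` has a smaller top index. -/
theorem mem_span_syzygy (i : S.ι) (z : S.ι →₀ MvPolynomial V K) (hz : S.map z = 0)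
    (hi : ∀ j, i < j → z j = 0) :
    z ∈ Submodule.span (MvPolynomial V K) (S.syzygy '' {x | x.1 ≤ i}) := by
  classical
  induction i using WellFoundedLT.induction generalizing z with
  | ind i ih =>
  have hmem : z i • S.g i ∈ Submodule.span (MvPolynomial V K) (S.g '' Set.Iio i) := by
    have h1 : z i • S.g i = - Finsupp.linearCombination _ S.g (z.erase i) := by
      have h2 := hz
      rw [map, ← Finsupp.single_add_erase i z, map_add, Finsupp.linearCombination_single] at h2
      rw [eq_neg_of_add_eq_zero_left h2]
    rw [h1]
    refine Submodule.neg_mem _ ((Finsupp.mem_span_image_iff_linearCombination _).2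
      ⟨_, (Finsupp.mem_supported _ _).2 fun j hj => ?_, rfl⟩)
    simp only [Finsupp.support_erase, Finset.coe_erase, Set.mem_sdiff, Finset.mem_coe,
      Finsupp.mem_support_iff, Set.mem_singleton_iff] at hj
    exact lt_of_le_of_ne (not_lt.1 fun h => hj.1 (hi j h)) hj.2
  rw [S.smul_mem_iff, ← Set.range_comp] at hmem
  obtain ⟨c, hc⟩ := (Submodule.mem_span_range_iff_exists_fun _).1 hmem
  let y := ∑ a, c a • S.syzygy ⟨i, a⟩
  have hy : y ∈ Submodule.span (MvPolynomial V K) (S.syzygy '' {x | x.1 ≤ i}) :=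
    Submodule.sum_mem _ fun a _ => Submodule.smul_mem _ _
      (Submodule.subset_span ⟨⟨i, a⟩, le_rfl, rfl⟩)
  have hyi : y i = z i := by
    rw [← hc]
    simp only [y, Finsupp.finsetSum_apply, Finsupp.smul_apply]
    exact Finset.sum_congr rfl fun a _ => by rw [S.syzygy_self ⟨i, a⟩]; rfl
  have hylt : ∀ j, i < j → y j = 0 := fun j hj => by
    simp only [y, Finsupp.finsetSum_apply, Finsupp.smul_apply]
    exact Finset.sum_eq_zero fun a _ => by rw [S.syzygy_of_lt (x := ⟨i, a⟩) hj, smul_zero]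
  have hymap : S.map y = 0 := by
    simp only [y, map_sum, map_smul, S.map_syzygy, smul_zero, Finset.sum_const_zero]
  rw [← sub_add_cancel z y]
  refine Submodule.add_mem _ ?_ hy
  have hlt : ∀ j, (z - y) j ≠ 0 → j < i := fun j hj => by
    rw [Finsupp.sub_apply] at hj
    rcases lt_trichotomy j i with h | h | h
    · exact h
    · subst h; rw [hyi, sub_self] at hj; exact absurd rfl hj
    · rw [hi j h, hylt j h, sub_self] at hj; exact absurd rfl hj
  by_cases h0 : (z - y).support.Nonempty
  · set j := (z - y).support.max' h0
    have hj : j < i := hlt j (Finsupp.mem_support_iff.1 (Finset.max'_mem _ h0))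
    refine Submodule.span_mono (Set.image_mono fun x hx => le_trans hx hj.le)
      (ih j hj (z - y) (by rw [map_sub, hz, hymap, sub_zero]) fun l hl => ?_)
    by_contra hne
    exact absurd (Finset.le_max' _ _ (Finsupp.mem_support_iff.2 hne)) (not_le.2 hl)
  · rw [Finset.not_nonempty_iff_eq_empty, Finsupp.support_eq_empty] at h0
    rw [h0]; exact Submodule.zero_mem _

theorem ker_map : LinearMap.ker S.map =
    Submodule.span (MvPolynomial V K) (Set.range S.syzygy) := by
  apply le_antisymm
  · intro z hz
    by_cases h0 : z.support.Nonempty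
    · refine Submodule.span_mono (Set.image_subset_range _ _)
        (S.mem_span_syzygy (z.support.max' h0) z hz fun l hl => ?_)
      by_contra hne
      exact absurd (Finset.le_max' _ _ (Finsupp.mem_support_iff.2 hne)) (not_le.2 hl)
    · rw [Finset.not_nonempty_iff_eq_empty, Finsupp.support_eq_empty] at h0
      rw [h0]; exact Submodule.zero_mem _
  · rw [Submodule.span_le]
    rintro _ ⟨x, rfl⟩
    exact S.map_syzygy x

theorem mem_span_syzygy_of_lt (i : S.ι) (z : S.ι →₀ MvPolynomial V K) (hz : S.map z = 0)
    (hi : ∀ j, i ≤ j → z j = 0) :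
    z ∈ Submodule.span (MvPolynomial V K) (S.syzygy '' {x | x.1 < i}) := by
  by_cases h0 : z.support.Nonempty
  · have hlt : z.support.max' h0 < i := by
      by_contra hne
      exact Finsupp.mem_support_iff.1 (Finset.max'_mem _ h0) (hi _ (not_lt.1 hne))
    refine Submodule.span_mono (Set.image_mono fun x hx => lt_of_le_of_lt hx hlt)
      (S.mem_span_syzygy (z.support.max' h0) z hz fun l hl => ?_)
    by_contra hne
    exact absurd (Finset.le_max' _ _ (Finsupp.mem_support_iff.2 hne)) (not_le.2 hl)
  · rw [Finset.not_nonempty_iff_eq_empty, Finsupp.support_eq_empty] at h0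
    rw [h0]; exact Submodule.zero_mem _

/-- In coordinate `i`, syzygies with smaller leading index vanish and those of block `i` are
distinct variables. Hence membership forces `p * X (s i a)` into the ideal of the earlier variables,
and then `p` itself. -/
theorem smul_syzygy_mem_iff (i : S.ι) (a : Fin (S.r i)) (p : MvPolynomial V K) :
    p • S.syzygy ⟨i, a⟩ ∈ Submodule.span (MvPolynomial V K)
        (S.syzygy '' {x | x.1 < i ∨ ∃ b < a, x = ⟨i, b⟩}) ↔
      p ∈ Ideal.span ((X : V → MvPolynomial V K) '' (S.s i '' Set.Iio a)) := by
  constructor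
  · intro h
    have hle : Submodule.span (MvPolynomial V K)
        (S.syzygy '' {x | x.1 < i ∨ ∃ b < a, x = ⟨i, b⟩}) ≤
        Submodule.comap (Finsupp.lapply i : (S.ι →₀ MvPolynomial V K) →ₗ[MvPolynomial V K] _)
          (Ideal.span ((X : V → MvPolynomial V K) '' (S.s i '' Set.Iio a))) := by
      rw [Submodule.span_le]
      rintro _ ⟨x, hx | ⟨b, hb, rfl⟩, rfl⟩
      · simp [S.syzygy_of_lt hx]
      · have : S.syzygy ⟨i, b⟩ i = X (S.s i b) := S.syzygy_self ⟨i, b⟩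
        simp only [Submodule.comap_coe, Set.mem_preimage, Finsupp.lapply_apply, this]
        exact Ideal.subset_span ⟨_, ⟨b, hb, rfl⟩, rfl⟩
    have h1 := hle h
    have h2 : S.syzygy ⟨i, a⟩ i = X (S.s i a) := S.syzygy_self ⟨i, a⟩
    rw [Submodule.mem_comap, Finsupp.lapply_apply, Finsupp.smul_apply, smul_eq_mul, h2] at h1
    refine (X_mul_mem_span_X_image_iff ?_ p).1 h1
    rintro ⟨b, hb, hba⟩
    exact absurd (S.s_injective i hba) (ne_of_lt hb)
  · intro h
    induction h using Submodule.span_induction with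
    | mem p hp =>
      obtain ⟨_, ⟨b, hb, rfl⟩, rfl⟩ := hp
      -- The Koszul combination of the two syzygies cancels in coordinate `i`, so it is spanned by
      -- the blocks below `i`.
      have hlt := S.mem_span_syzygy_of_lt i
        ((X (S.s i b) : MvPolynomial V K) • S.syzygy ⟨i, a⟩ -
          (X (S.s i a) : MvPolynomial V K) • S.syzygy ⟨i, b⟩)
        (by simp [map_syzygy]) fun j hj => by
          rcases hj.lt_or_eq with h | rfl
          · simp [S.syzygy_of_lt (x := ⟨i, a⟩) h, S.syzygy_of_lt (x := ⟨i, b⟩) h]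
          · have ha : S.syzygy ⟨i, a⟩ i = X (S.s i a) := S.syzygy_self ⟨i, a⟩
            have hb : S.syzygy ⟨i, b⟩ i = X (S.s i b) := S.syzygy_self ⟨i, b⟩
            simp [ha, hb, mul_comm]
      rw [← sub_add_cancel ((X (S.s i b) : MvPolynomial V K) • S.syzygy ⟨i, a⟩)
        ((X (S.s i a) : MvPolynomial V K) • S.syzygy ⟨i, b⟩)]
      exact Submodule.add_mem _ (Submodule.span_mono (Set.image_mono fun x hx => Or.inl hx) hlt)
        (Submodule.smul_mem _ _ (Submodule.subset_span ⟨_, Or.inr ⟨b, hb, rfl⟩, rfl⟩))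
    | zero => rw [zero_smul]; exact Submodule.zero_mem _
    | add p q _ _ hp hq => rw [add_smul]; exact Submodule.add_mem _ hp hq
    | smul r p _ hp => rw [smul_assoc]; exact Submodule.smul_mem _ _ hp

/-- The first syzygies of a linear quotient system, generated by linear syzygies which again form
a linear quotient system in the lexicographic order. -/
noncomputable def next : LinearQuotientSystem V K where
  κ := S.ι
  ι := Σₗ i, Fin (S.r i)
  linearOrder := inferInstance
  fintype := inferInstanceAs (Fintype (Σ i, Fin (S.r i)))
  deg := 1
  g x := S.syzygy (ofLex x)
  homogeneous _ _ := S.syzygy_isHomogeneous _ _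
  -- Counting from zero, the variables preceding the `a`-th one number exactly `a`.
  r x := (ofLex x).2
  s x b := S.s (ofLex x).1 ⟨b, b.2.trans (ofLex x).2.2⟩
  s_injective x b c h := by
    have := S.s_injective _ h
    simpa [Fin.ext_iff] using this
  smul_mem_iff x p := by
    have h1 : (fun y : Σₗ i, Fin (S.r i) => S.syzygy (ofLex y)) '' Set.Iio x =
        S.syzygy '' {y | y.1 < (ofLex x).1 ∨ ∃ b < (ofLex x).2, y = ⟨(ofLex x).1, b⟩} := by
      obtain ⟨i, a⟩ := x
      ext z
      constructor
      · rintro ⟨⟨j, b⟩, hy, rfl⟩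
        refine ⟨⟨j, b⟩, ?_, rfl⟩
        rcases Sigma.lex_iff.1 hy with h | ⟨h, h'⟩
        · exact Or.inl h
        · cases h; exact Or.inr ⟨b, h', rfl⟩
      · rintro ⟨y, hy, rfl⟩
        refine ⟨y, Sigma.lex_iff.2 ?_, rfl⟩
        rcases hy with h | ⟨b, hb, rfl⟩
        · exact Or.inl h
        · exact Or.inr ⟨rfl, hb⟩
    have h2 : Set.range (fun b : Fin (ofLex x).2 => S.s (ofLex x).1 ⟨b, b.2.trans (ofLex x).2.2⟩) =
        S.s (ofLex x).1 '' Set.Iio (ofLex x).2 := by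
      ext v
      constructor
      · rintro ⟨b, rfl⟩
        exact ⟨_, b.2, rfl⟩
      · rintro ⟨b, hb, rfl⟩
        exact ⟨⟨b, hb⟩, rfl⟩
    rw [h1, h2]
    exact S.smul_syzygy_mem_iff _ _ p

/-- The iterated syzygies of a linear quotient system. -/
noncomputable def iter : ℕ → LinearQuotientSystem V K
  | 0 => S
  | n + 1 => (iter n).next

theorem exact_next (T : LinearQuotientSystem V K) : Function.Exact T.next.map T.map :=
  LinearMap.exact_iff.2 (T.ker_map.trans (Finsupp.range_linearCombination _).symm)

theorem map_single (T : LinearQuotientSystem V K) (k : T.ι) :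
    T.map (Finsupp.single k 1) = T.g k := by
  rw [map, Finsupp.linearCombination_single, one_smul]

theorem map_single_isHomogeneous (T : LinearQuotientSystem V K) (k : T.ι) (j : T.κ) :
    (T.map (Finsupp.single k 1) j).IsHomogeneous T.deg := by
  rw [map_single]
  exact T.homogeneous _ _

theorem range_lapply_comp_map (T : LinearQuotientSystem V K) (j : T.κ) :
    LinearMap.range (Finsupp.lapply j ∘ₗ T.map) = Ideal.span (Set.range fun i => T.g i j) := by
  rw [LinearMap.range_comp, map, Finsupp.range_linearCombination, Submodule.map_span,
    ← Set.range_comp]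
  rfl

/-- The graded free resolution of an ideal given by the iterated syzygies of a linear quotient
system of generators. -/
noncomputable def resolution (k₀ : S.κ) (hk : ∀ k, k = k₀) (I : Ideal (MvPolynomial V K))
    (hI : Ideal.span (Set.range fun i => S.g i k₀) = I) : GradedFreeResolution I where
  ι n := (S.iter n).ι
  finite n := inferInstance
  -- Only the initial system has degree `S.deg`; every later one has degree 1.
  shift n _ := S.deg + n
  aug := Finsupp.lapply k₀ ∘ₗ S.map
  d n := (S.iter (n + 1)).map
  aug_homogeneous k := S.map_single_isHomogeneous k k₀
  d_homogeneous n k j := by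
    have h : S.deg + (n + 1) - (S.deg + n) = 1 := by omega
    rw [h]
    exact (S.iter (n + 1)).map_single_isHomogeneous k j
  d_eq_zero n k j h := by omega
  range_aug := (S.range_lapply_comp_map k₀).trans hI
  exact_aug := by
    have h := S.exact_next
    intro z
    refine Iff.trans ?_ (h z)
    refine ⟨fun hz => Finsupp.ext fun k => ?_, fun hz => ?_⟩
    · rw [hk k]; exact hz
    · exact congrArg (fun f => f k₀) hz
  exact_d n := (S.iter (n + 1)).exact_next

end LinearQuotientSystem

theorem LinearQuotientSystem.hasLinearResolution (S : LinearQuotientSystem V K) (k₀ : S.κ)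
    (hk : ∀ k, k = k₀) (I : Ideal (MvPolynomial V K))
    (hI : Ideal.span (Set.range fun i => S.g i k₀) = I) : HasLinearResolution I := by
  refine ⟨S.deg, S.resolution k₀ hk I hI, fun n k j => ?_, fun _ _ => rfl⟩
  have h : ((S.resolution k₀ hk I hI).d n (Finsupp.single k 1) j).IsHomogeneous 1 :=
    (S.iter (n + 1)).map_single_isHomogeneous k j
  rw [constantCoeff_eq]
  exact h.coeff_eq_zero (by simp)

end LinearQuotientSystems

/-! ### Monomial ideals with linear quotients -/

section MonomialIdeals

variable {V : Type*} {K : Type*} [Field K]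

theorem IsMonomialIdeal.eq_span_minGens [Finite V] {I : Ideal (MvPolynomial V K)}
    (hI : IsMonomialIdeal I) :
    I = Ideal.span ((fun a => monomial a (1 : K)) '' minGens I) := by
  apply le_antisymm
  · obtain ⟨A, hA⟩ := hI
    conv_lhs => rw [hA]
    rw [Ideal.span_le]
    rintro _ ⟨a, ha, rfl⟩
    have haI : monomial a (1 : K) ∈ I := by
      rw [hA]; exact Ideal.subset_span ⟨a, ha, rfl⟩
    obtain ⟨b, hba, hb⟩ := exists_minimal_le_of_wellFoundedLT
      (fun b : V →₀ ℕ => monomial b (1 : K) ∈ I) a haI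
    refine mem_ideal_span_monomial_image.2 fun m hm => ⟨b, hb, ?_⟩
    rwa [Finset.mem_singleton.1 (support_monomial_subset hm)]
  · rw [Ideal.span_le]
    rintro _ ⟨a, ha, rfl⟩
    exact ha.1

theorem IsLinearQuotientIdeal.hasLinearResolution [Finite V] {I : Ideal (MvPolynomial V K)}
    (hI : IsLinearQuotientIdeal I) : HasLinearResolution I := by
  classical
  obtain ⟨hmon, m, a, -, hrange, hcolon, hdeg⟩ := hI
  have hq : ∃ q, ∀ i, (a i).degree = q := by
    rcases isEmpty_or_nonempty (Fin m) with h | ⟨⟨i⟩⟩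
    · exact ⟨0, fun i => h.elim i⟩
    · exact ⟨_, fun j => hdeg j i⟩
  obtain ⟨q, hq⟩ := hq
  choose S hS using hcolon
  -- The generators are viewed as vectors in a free module of rank one.
  let T : LinearQuotientSystem V K :=
    { κ := Unit
      ι := Fin m
      linearOrder := inferInstance
      fintype := inferInstance
      deg := q
      g := fun i => Finsupp.single () (monomial (a i) 1)
      homogeneous := fun i k => by
        rw [Finsupp.single_apply, if_pos rfl]
        exact isHomogeneous_monomial _ (hq i)
      r := fun i => Nat.card (S i)
      s := fun i b => ((Finite.equivFin (S i)).symm b : V)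
      s_injective := fun i => Subtype.val_injective.comp (Equiv.injective _)
      smul_mem_iff := fun i p => by
        have h1 : Set.range (fun b => ((Finite.equivFin (S i)).symm b : V)) = S i := by
          rw [show (fun b => ((Finite.equivFin (S i)).symm b : V)) =
            Subtype.val ∘ (Finite.equivFin (S i)).symm from rfl, Set.range_comp,
            Equiv.range_eq_univ, Set.image_univ, Subtype.range_coe]
        rw [h1, ← hS i, Submodule.mem_colon_singleton]
        let e : MvPolynomial V K ≃ₗ[MvPolynomial V K] (Unit →₀ MvPolynomial V K) :=
          (Finsupp.uniqueLinearEquiv _ _ ()).symm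
        have he : ∀ p, e p = Finsupp.single () p := fun p => rfl
        have h2 : (fun i : Fin m => Finsupp.single () (monomial (a i) (1 : K))) '' Set.Iio i =
            e '' {p | ∃ j : Fin m, j < i ∧ p = monomial (a j) 1} := by
          ext z
          constructor
          · rintro ⟨j, hj, rfl⟩
            exact ⟨_, ⟨j, hj, rfl⟩, he _⟩
          · rintro ⟨_, ⟨j, hj, rfl⟩, rfl⟩
            exact ⟨j, hj, (he _).symm⟩
        rw [h2, ← LinearEquiv.coe_coe, Submodule.span_image, ← he, ← map_smul,]
        rw [Submodule.mem_map_equiv, LinearEquiv.symm_apply_apply]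
        rfl }
  refine T.hasLinearResolution () (fun _ => rfl) I ?_
  have h3 : (fun i : T.ι => T.g i ()) = (fun a => monomial a (1 : K)) ∘ a := by
    funext i
    exact Finsupp.single_eq_same
  rw [h3, Set.range_comp, hrange]
  exact hmon.eq_span_minGens.symm

end MonomialIdeals

/-! ### What linear first syzygies say about the generators -/

section LinearResolutions

variable {V : Type*} {K : Type*} [Field K]

theorem snd_le_of_mem_antidiagonal [DecidableEq V] {m : V →₀ ℕ} {x : (V →₀ ℕ) × (V →₀ ℕ)}
    (hx : x ∈ Finset.HasAntidiagonal.antidiagonal m) : x.2 ≤ m := by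
  rw [← Finset.HasAntidiagonal.mem_antidiagonal.1 hx]
  exact le_add_self

theorem IsMonomialIdeal.monomial_mem {I : Ideal (MvPolynomial V K)} (hI : IsMonomialIdeal I)
    {p : MvPolynomial V K} (hp : p ∈ I) {m : V →₀ ℕ} (hm : coeff m p ≠ 0) :
    monomial m (1 : K) ∈ I := by
  obtain ⟨A, rfl⟩ := hI
  obtain ⟨a, ha, ham⟩ := mem_ideal_span_monomial_image.1 hp m (mem_support_iff.2 hm)
  refine mem_ideal_span_monomial_image.2 fun n hn => ⟨a, ha, ?_⟩
  rwa [Finset.mem_singleton.1 (support_monomial_subset hn)]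

theorem linearMap_apply_eq_sum {R ι M : Type*} [CommRing R] [Fintype ι] [AddCommGroup M]
    [Module R M] (f : (ι →₀ R) →ₗ[R] M) (z : ι →₀ R) :
    f z = ∑ k, z k • f (Finsupp.single k 1) := by
  classical
  conv_lhs => rw [← Finsupp.univ_sum_single z]
  rw [map_sum]
  refine Finset.sum_congr rfl fun k _ => ?_
  rw [← map_smul, Finsupp.smul_single, smul_eq_mul, mul_one]

theorem exists_restriction (A : Set (V →₀ ℕ)) (p : MvPolynomial V K) :
    ∃ p' : MvPolynomial V K, (∀ m ∈ A, coeff m p' = coeff m p) ∧ ∀ m ∉ A, coeff m p' = 0 := by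
  classical
  refine ⟨∑ n ∈ p.support with n ∈ A, monomial n (coeff n p), fun m hm => ?_, fun m hm => ?_⟩
  · simp only [coeff_sum, coeff_monomial, Finset.sum_ite_eq', Finset.mem_filter, hm, and_true,
      mem_support_iff]
    split_ifs with h
    · rfl
    · exact (not_not.1 h).symm
  · simp [coeff_sum, coeff_monomial, hm]

/-- The ideal of the polynomials none of whose monomials divides the monomial with exponent
`u`. -/
def nonDivisorIdeal (K : Type*) [Field K] (u : V →₀ ℕ) : Ideal (MvPolynomial V K) where
  carrier := {p | ∀ m ≤ u, coeff m p = 0}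
  zero_mem' := fun m _ => coeff_zero m
  add_mem' hp hq m hm := by rw [coeff_add, hp m hm, hq m hm, add_zero]
  smul_mem' c p hp m hm := by
    classical
    rw [smul_eq_mul, coeff_mul]
    refine Finset.sum_eq_zero fun x hx => ?_
    rw [hp x.2 ((snd_le_of_mem_antidiagonal hx).trans hm), mul_zero]

/-- The steps, among the monomials of degree `q` in `I` dividing the monomial with exponent `u`,
between two monomials whose least common multiple has degree at most `q + 1`. -/
def LinearStep (I : Ideal (MvPolynomial V K)) (q : ℕ) (u c d : V →₀ ℕ) : Prop :=
  monomial d (1 : K) ∈ I ∧ d.degree = q ∧ d ≤ u ∧ (c ⊔ d).degree ≤ q + 1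

namespace GradedFreeResolution

variable {I : Ideal (MvPolynomial V K)} (P : GradedFreeResolution I) {q : ℕ}

theorem aug_mem (z : P.ι 0 →₀ MvPolynomial V K) : P.aug z ∈ I := by
  have h := LinearMap.mem_range_self P.aug z
  rwa [P.range_aug] at h

/-- Some image of a basis vector contains a monomial dividing `a`. It lies in `I`, so minimality
makes it equal to `a`, and its degree is `q`. -/
theorem degree_of_mem_minGens (hI : IsMonomialIdeal I) (hP : ∀ k, P.shift 0 k = q)
    {a : V →₀ ℕ} (ha : a ∈ minGens I) : a.degree = q := by
  classical
  have := P.finite 0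
  have := Fintype.ofFinite (P.ι 0)
  obtain ⟨y, hy⟩ : monomial a (1 : K) ∈ LinearMap.range P.aug := by rw [P.range_aug]; exact ha.1
  rw [linearMap_apply_eq_sum] at hy
  have h1 : coeff a (∑ k, y k • P.aug (Finsupp.single k 1)) ≠ 0 := by
    rw [hy, coeff_monomial, if_pos rfl]; exact one_ne_zero
  rw [coeff_sum] at h1
  obtain ⟨k, -, hk⟩ := Finset.exists_ne_zero_of_sum_ne_zero h1
  rw [smul_eq_mul, coeff_mul] at hk
  obtain ⟨x, hx, hne⟩ := Finset.exists_ne_zero_of_sum_ne_zero hk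
  have hb := right_ne_zero_of_mul hne
  have hle : x.2 ≤ a := snd_le_of_mem_antidiagonal hx
  have heq : x.2 = a := le_antisymm hle (ha.2 (hI.monomial_mem (P.aug_mem _) hb) hle)
  by_contra hdeg
  refine hb ((P.aug_homogeneous k).coeff_eq_zero ?_)
  rwa [heq, hP]

/-- In degree `q` only the constant terms of the coefficients of a preimage contribute. -/
theorem exists_aug_eq_monomial (hP : ∀ k, P.shift 0 k = q) {a : V →₀ ℕ}
    (ha : monomial a (1 : K) ∈ I) (hdeg : a.degree = q) :
    ∃ y : P.ι 0 →₀ K, P.aug (y.mapRange C (map_zero _)) = monomial a 1 := by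
  have := P.finite 0
  have := Fintype.ofFinite (P.ι 0)
  obtain ⟨y, hy⟩ : monomial a (1 : K) ∈ LinearMap.range P.aug := by rw [P.range_aug]; exact ha
  refine ⟨y.mapRange (coeff 0) (coeff_zero _), ?_⟩
  rw [linearMap_apply_eq_sum] at hy ⊢
  have h1 := congrArg (homogeneousComponent (0 + q)) hy
  rw [map_sum, homogeneousComponent_eq_self (isHomogeneous_monomial _ (by omega))] at h1
  rw [← h1]
  refine Finset.sum_congr rfl fun k _ => ?_
  have hk := P.aug_homogeneous k
  rw [hP] at hk
  rw [smul_eq_mul, smul_eq_mul, homogeneousComponent_mul_of_isHomogeneous _ hk,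
    homogeneousComponent_zero, Finsupp.mapRange_apply, Finsupp.mapRange_apply]

/-- If some `c ∈ A` divides `m`, any degree `q` monomial of `I` dividing `m` is one step from `c`,
because both divide `m`, of degree `q + 1`. It is thus in `A`, and truncating to `A` changes nothing
at `m`. If no such `c` exists, truncated polynomials contribute nothing at `m`. -/
theorem coeff_mul_restriction (hI : IsMonomialIdeal I) {A : Set (V →₀ ℕ)} {u m : V →₀ ℕ}
    (hA : ∀ c ∈ A, ∀ d, LinearStep I q u c d → d ∈ A) (hm : m ≤ u)
    (hmdeg : m.degree = q + 1) :
    (∀ l g g' : MvPolynomial V K, g ∈ I → g.IsHomogeneous q →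
        (∀ n ∈ A, coeff n g' = coeff n g) → (∀ n ∉ A, coeff n g' = 0) →
        coeff m (l * g') = coeff m (l * g)) ∨
      ∀ l g' : MvPolynomial V K, (∀ n ∉ A, coeff n g' = 0) → coeff m (l * g') = 0 := by
  classical
  by_cases hex : ∃ c ∈ A, c ≤ m
  · obtain ⟨c, hcA, hcm⟩ := hex
    left
    intro l g g' hgI hg h1 h2
    rw [coeff_mul, coeff_mul]
    refine Finset.sum_congr rfl fun x hx => ?_
    have hxm : x.2 ≤ m := snd_le_of_mem_antidiagonal hx
    by_cases hxA : x.2 ∈ A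
    · rw [h1 _ hxA]
    · rw [h2 _ hxA]
      by_cases h0 : coeff x.2 g = 0
      · rw [h0]
      · refine absurd (hA c hcA x.2 ⟨hI.monomial_mem hgI h0, ?_, hxm.trans hm, ?_⟩) hxA
        · by_contra hne
          exact h0 (hg.coeff_eq_zero hne)
        · rw [← hmdeg]
          exact Finsupp.degree_mono (sup_le hcm hxm)
  · right
    intro l g' h2
    rw [coeff_mul]
    refine Finset.sum_eq_zero fun x hx => ?_
    have hxm : x.2 ≤ m := snd_le_of_mem_antidiagonal hx
    rw [h2 _ fun hxA => hex ⟨_, hxA, hxm⟩, mul_zero]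

/-- Truncating the generators to the set `A` reachable from `a` gives a map `ψ` that still kills
linear syzygies modulo monomials not dividing `u`. If `b ∉ A`, then `ψ` sends the syzygy between `a`
and `b` to the monomial `u`, a contradiction. -/
theorem reflTransGen_linearStep (hI : IsMonomialIdeal I) (hP0 : ∀ k, P.shift 0 k = q)
    (hP1 : ∀ k, P.shift 1 k = q + 1) {a b : V →₀ ℕ} (ha : monomial a (1 : K) ∈ I)
    (hb : monomial b (1 : K) ∈ I) (hadeg : a.degree = q) (hbdeg : b.degree = q) :
    Relation.ReflTransGen (LinearStep I q (a ⊔ b)) a b := by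
  classical
  have := P.finite 0
  have := Fintype.ofFinite (P.ι 0)
  by_contra hab
  set u := a ⊔ b
  let A : Set (V →₀ ℕ) := {c | Relation.ReflTransGen (LinearStep I q u) a c}
  have hA : ∀ c ∈ A, ∀ d, LinearStep I q u c d → d ∈ A := fun c hc d hd => hc.tail hd
  let g : P.ι 0 → MvPolynomial V K := fun k => P.aug (Finsupp.single k 1)
  have hgI : ∀ k, g k ∈ I := fun k => P.aug_mem _
  have hg : ∀ k, (g k).IsHomogeneous q := fun k => hP0 k ▸ P.aug_homogeneous k
  choose g' hg1 hg2 using fun k => exists_restriction A (g k)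
  have hg' : ∀ k, (g' k).IsHomogeneous q := fun k m hm => by
    by_cases hmA : m ∈ A
    · rw [hg1 k m hmA] at hm; exact hg k hm
    · exact absurd (hg2 k m hmA) hm
  let ψ := Finsupp.linearCombination (MvPolynomial V K) g'
  have hψ : ∀ z, ψ z = ∑ k, z k * g' k := fun z => by
    rw [linearMap_apply_eq_sum ψ z]
    simp [ψ]
  have hsingle : ∀ l, ψ (P.d 0 (Finsupp.single l 1)) ∈ nonDivisorIdeal K u := by
    intro l m hm
    have hD : ∀ k, (P.d 0 (Finsupp.single l 1) k).IsHomogeneous 1 := fun k => by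
      have := P.d_homogeneous 0 l k
      rwa [hP0, hP1, show q + 1 - q = 1 by omega] at this
    rw [hψ]
    -- The image is homogeneous of degree `q + 1`, so other degrees are trivial. In this degree its
    -- coefficient at `m` is either that of `aug ∘ d = 0` or a sum of zeros.
    by_cases hmdeg : m.degree = q + 1
    · rw [coeff_sum]
      rcases coeff_mul_restriction hI hA hm hmdeg with h | h
      · have h0 : P.aug (P.d 0 (Finsupp.single l 1)) = 0 := P.exact_aug.apply_apply_eq_zero _
        rw [linearMap_apply_eq_sum] at h0
        have h1 := congrArg (coeff m) h0
        rw [coeff_sum, coeff_zero] at h1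
        rw [← h1]
        exact Finset.sum_congr rfl fun k _ => h _ _ _ (hgI k) (hg k) (hg1 k) (hg2 k)
      · exact Finset.sum_eq_zero fun k _ => h _ _ (hg2 k)
    · refine IsHomogeneous.coeff_eq_zero (n := 1 + q) ?_ (by omega)
      exact IsHomogeneous.sum _ _ _ fun k _ => (hD k).mul (hg' k)
  have hrange : ∀ z, ψ (P.d 0 z) ∈ nonDivisorIdeal K u := by
    intro z
    induction z using Finsupp.induction_linear with
    | zero => rw [map_zero, map_zero]; exact Submodule.zero_mem _
    | add z w hz hw => rw [map_add, map_add]; exact Submodule.add_mem _ hz hw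
    | single l c =>
      rw [← mul_one c, ← smul_eq_mul, ← Finsupp.smul_single, map_smul, map_smul]
      exact Submodule.smul_mem _ _ (hsingle l)
  have hψC : ∀ (y : P.ι 0 →₀ K) (c m : V →₀ ℕ),
      P.aug (y.mapRange C (map_zero _)) = monomial c 1 →
      coeff m (ψ (y.mapRange C (map_zero _))) =
        if m ∈ A then coeff m (monomial c (1 : K)) else 0 := by
    intro y c m hy
    rw [hψ, ← hy, linearMap_apply_eq_sum, coeff_sum, coeff_sum]
    split_ifs with hmA
    · refine Finset.sum_congr rfl fun k _ => ?_
      rw [smul_eq_mul, Finsupp.mapRange_apply, coeff_C_mul, coeff_C_mul, hg1 k m hmA]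
    · refine Finset.sum_eq_zero fun k _ => ?_
      rw [Finsupp.mapRange_apply, coeff_C_mul, hg2 k m hmA, mul_zero]
  obtain ⟨ya, hya⟩ := P.exists_aug_eq_monomial hP0 ha hadeg
  obtain ⟨yb, hyb⟩ := P.exists_aug_eq_monomial hP0 hb hbdeg
  have hψa : ψ (ya.mapRange C (map_zero _)) = monomial a 1 := by
    ext m
    rw [hψC ya a m hya, coeff_monomial]
    split_ifs with h1 h2 h2
    · rfl
    · rfl
    · subst h2; exact absurd Relation.ReflTransGen.refl h1
    · rfl
  have hψb : ψ (yb.mapRange C (map_zero _)) = 0 := by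
    ext m
    rw [hψC yb b m hyb, coeff_monomial, coeff_zero]
    split_ifs with h1 h2
    · subst h2; exact absurd h1 hab
    · rfl
    · rfl
  -- A lift of the relation equating the multiples of `a` and `b` that give their lcm `u`; `ψ` keeps
  -- only the first summand.
  let w : P.ι 0 →₀ MvPolynomial V K := (monomial (u - a) (1 : K)) • ya.mapRange C (map_zero _) -
    (monomial (u - b) (1 : K)) • yb.mapRange C (map_zero _)
  have hua : u - a + a = u := tsub_add_cancel_of_le le_sup_left
  have hub : u - b + b = u := tsub_add_cancel_of_le le_sup_right
  have hw : P.aug w = 0 := by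
    simp only [w, map_sub, map_smul, hya, hyb, smul_eq_mul, monomial_mul, hua, hub, sub_self]
  obtain ⟨z, hz⟩ := (P.exact_aug w).1 hw
  have hfin := hrange z u le_rfl
  rw [hz] at hfin
  simp only [w, map_sub, map_smul, hψa, hψb, smul_eq_mul, monomial_mul, hua, mul_one, mul_zero,
    sub_zero, coeff_monomial, if_true] at hfin
  exact one_ne_zero hfin

end GradedFreeResolution

theorem HasLinearResolution.exists_reflTransGen_linearStep {I : Ideal (MvPolynomial V K)}
    (hI : IsMonomialIdeal I) (h : HasLinearResolution I) :
    ∃ q, (∀ a ∈ minGens I, a.degree = q) ∧ ∀ a ∈ minGens I, ∀ b ∈ minGens I,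
      Relation.ReflTransGen (LinearStep I q (a ⊔ b)) a b := by
  obtain ⟨q, P, -, hP⟩ := h
  have hq : ∀ a ∈ minGens I, a.degree = q := fun a ha =>
    P.degree_of_mem_minGens hI (fun k => hP 0 k) ha
  exact ⟨q, hq, fun a ha b hb => P.reflTransGen_linearStep hI (fun k => hP 0 k) (fun k => hP 1 k)
    ha.1 hb.1 (hq a ha) (hq b hb)⟩

end LinearResolutions

/-! ### Linearly connected families of sets with leaves -/

section SetFamilies

variable {V : Type*} [DecidableEq V]

/-- The steps, among the members of `𝓕` contained in `U`, between two sets whose union has at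
most `q + 1` elements. -/
def FamilyStep (𝓕 : Set (Finset V)) (q : ℕ) (U A B : Finset V) : Prop :=
  B ∈ 𝓕 ∧ B ⊆ U ∧ (A ∪ B).card ≤ q + 1

/-- All members of `𝓕` have `q` elements, and any two of them are joined, inside their union, by a
sequence of members of `𝓕` in which consecutive sets differ in at most one element. -/
def IsLinearlyConnected (𝓕 : Set (Finset V)) (q : ℕ) : Prop :=
  (∀ F ∈ 𝓕, F.card = q) ∧
    ∀ F ∈ 𝓕, ∀ G ∈ 𝓕, Relation.ReflTransGen (FamilyStep 𝓕 q (F ∪ G)) F G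

/-- Every nonempty finite subfamily has a leaf. -/
def HasLeaves (𝓕 : Set (Finset V)) : Prop :=
  ∀ 𝓖 : Finset (Finset V), ↑𝓖 ⊆ 𝓕 → 𝓖.Nonempty → ∃ F ∈ 𝓖, (∀ H ∈ 𝓖, H = F) ∨
    ∃ G ∈ 𝓖, G ≠ F ∧ ∀ H ∈ 𝓖, H ≠ F → F ∩ H ⊆ F ∩ G

/-- A path may revisit `B`; `C` is the set just before its first arrival there. -/
theorem FamilyStep.exists_last_ne {𝓕 : Set (Finset V)} {q : ℕ} {U A B : Finset V}
    (h : Relation.ReflTransGen (FamilyStep 𝓕 q U) A B) (hA : A ∈ 𝓕) (hU : A ⊆ U) (hAB : A ≠ B) :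
    ∃ C ∈ 𝓕, C ≠ B ∧ C ⊆ U ∧ (C ∪ B).card ≤ q + 1 := by
  induction h using Relation.ReflTransGen.head_induction_on with
  | refl => exact absurd rfl hAB
  | @head A C hAC _ ih =>
    by_cases hCB : C = B
    · subst hCB
      exact ⟨A, hA, hAB, hU, hAC.2.2⟩
    · exact ih hAC.1 hAC.2.1 hCB

theorem card_sdiff_eq_one {q : ℕ} {A B : Finset V} (hA : A.card = q) (hB : B.card = q)
    (hne : A ≠ B) (h : (A ∪ B).card ≤ q + 1) : (A \ B).card = 1 := by
  have h1 : (A \ B).card + B.card = (A ∪ B).card := Finset.card_sdiff_add_card A B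
  have h2 : (A \ B).card ≠ 0 := fun h0 => by
    rw [Finset.card_eq_zero, Finset.sdiff_eq_empty_iff_subset] at h0
    exact hne (Finset.eq_of_subset_of_card_le h0 (by omega))
  omega

/-- On a path from `H` to `F`, the set preceding `F` lies in `H ∪ F`, so its one element outside `F`
comes from `H`. This is the linear quotient condition with `F` placed last. -/
theorem IsLinearlyConnected.exists_sdiff_eq_singleton {𝓕 : Set (Finset V)} {q : ℕ}
    (h : IsLinearlyConnected 𝓕 q) {F H : Finset V} (hF : F ∈ 𝓕) (hH : H ∈ 𝓕) (hne : H ≠ F) :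
    ∃ A ∈ 𝓕, A ≠ F ∧ ∃ v ∈ H \ F, A \ F = {v} := by
  obtain ⟨A, hA, hAF, hAU, hcard⟩ := FamilyStep.exists_last_ne (h.2 H hH F hF) hH
    Finset.subset_union_left hne
  obtain ⟨v, hv⟩ := Finset.card_eq_one.1 (card_sdiff_eq_one (h.1 A hA) (h.1 F hF) hAF hcard)
  have hvA : v ∈ A \ F := hv ▸ Finset.mem_singleton_self v
  rw [Finset.mem_sdiff] at hvA
  refine ⟨A, hA, hAF, v, Finset.mem_sdiff.2 ⟨?_, hvA.2⟩, hv⟩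
  exact (Finset.mem_union.1 (hAU hvA.1)).resolve_right hvA.2

/-- A path joining `A` and `B` stays inside `A ∪ B`, hence never visits `F`. -/
theorem IsLinearlyConnected.sdiff_singleton {𝓕 : Set (Finset V)} {q : ℕ}
    (h : IsLinearlyConnected 𝓕 q) {F : Finset V}
    (hF : ∀ A ∈ 𝓕, ∀ B ∈ 𝓕, A ≠ F → B ≠ F → ¬ F ⊆ A ∪ B) :
    IsLinearlyConnected (𝓕 \ {F}) q := by
  refine ⟨fun A hA => h.1 A hA.1, fun A hA B hB =>
    Relation.ReflTransGen.mono ?_ _ _ (h.2 A hA.1 B hB.1)⟩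
  rintro C D ⟨hD, hDU, hCD⟩
  refine ⟨⟨hD, fun hDF => ?_⟩, hDU, hCD⟩
  exact hF A hA.1 B hB.1 hA.2 hB.2 (hDF ▸ hDU)

theorem IsLinearlyConnected.exists_linearQuotient_order {q : ℕ} (𝓕 : Finset (Finset V))
    (hlc : IsLinearlyConnected (𝓕 : Set (Finset V)) q)
    (hleaf : HasLeaves (𝓕 : Set (Finset V))) :
    ∃ (m : ℕ) (a : Fin m → Finset V), Function.Injective a ∧ Set.range a = ↑𝓕 ∧
      ∀ i, ∀ j < i, ∃ k < i, ∃ v ∈ a j \ a i, a k \ a i = {v} := by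
  induction 𝓕 using Finset.strongInduction with
  | H 𝓕 ih =>
  rcases 𝓕.eq_empty_or_nonempty with rfl | hne
  · exact ⟨0, Fin.elim0, fun i => i.elim0, by simp, fun i => i.elim0⟩
  obtain ⟨F, hF, hFleaf⟩ := hleaf 𝓕 subset_rfl hne
  -- If a leaf `F` were covered by `A ∪ B`, both `F ∩ A` and `F ∩ B` would lie in the joint `G`, so
  -- `F ⊆ G`, and equal cardinality would give `F = G`.
  have hrem : ∀ A ∈ 𝓕, ∀ B ∈ 𝓕, A ≠ F → B ≠ F → ¬ F ⊆ A ∪ B := by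
    intro A hA B hB hAF hBF hsub
    rcases hFleaf with honly | ⟨G, hG, hGF, hmax⟩
    · exact hAF (honly A hA)
    · have hFG : F ⊆ G := by
        intro v hv
        rcases Finset.mem_union.1 (hsub hv) with hvA | hvB
        · exact (Finset.mem_inter.1 (hmax A hA hAF (Finset.mem_inter.2 ⟨hv, hvA⟩))).2
        · exact (Finset.mem_inter.1 (hmax B hB hBF (Finset.mem_inter.2 ⟨hv, hvB⟩))).2
      refine hGF (Finset.eq_of_subset_of_card_le hFG ?_).symm
      rw [hlc.1 F hF, hlc.1 G hG]
  have hlc' : IsLinearlyConnected (↑(𝓕.erase F) : Set (Finset V)) q := by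
    rw [Finset.coe_erase]
    exact hlc.sdiff_singleton hrem
  have hsub : (↑(𝓕.erase F) : Set (Finset V)) ⊆ ↑𝓕 := Finset.coe_subset.2 (Finset.erase_subset _ _)
  obtain ⟨m, a, hinj, hrange, hcol⟩ := ih _ (Finset.erase_ssubset hF) hlc'
    fun 𝓖 h𝓖 h => hleaf 𝓖 (h𝓖.trans hsub) h
  have ha : ∀ A, A ∈ 𝓕 → A ≠ F → ∃ k, a k = A := fun A hA hAF => by
    have : A ∈ Set.range a := by
      rw [hrange]; exact Finset.mem_coe.2 (Finset.mem_erase.2 ⟨hAF, hA⟩)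
    exact this
  have ha' : ∀ k, a k ∈ 𝓕 ∧ a k ≠ F := fun k => by
    have : a k ∈ (↑(𝓕.erase F) : Set (Finset V)) := hrange ▸ Set.mem_range_self k
    exact (Finset.mem_erase.1 this).symm
  refine ⟨m + 1, Fin.snoc a F, ?_, ?_, ?_⟩
  · refine Fin.snoc_injective_iff.2 ⟨hinj, ?_⟩
    rintro ⟨k, hk⟩
    exact (ha' k).2 hk
  · ext A
    constructor
    · rintro ⟨i, rfl⟩
      induction i using Fin.lastCases with
      | last => simpa using hF
      | cast i => simpa using (ha' i).1
    · intro hA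
      by_cases hAF : A = F
      · exact ⟨Fin.last m, by simp [hAF]⟩
      · obtain ⟨k, hk⟩ := ha A hA hAF
        exact ⟨k.castSucc, by simp [hk]⟩
  · intro i j hij
    induction j using Fin.lastCases with
    | last => exact absurd (Fin.le_last i) (not_le.2 hij)
    | cast j =>
      induction i using Fin.lastCases with
      | last =>
        obtain ⟨A, hA, hAF, v, hv, hAv⟩ :=
          hlc.exists_sdiff_eq_singleton hF (ha' j).1 (ha' j).2
        obtain ⟨k, rfl⟩ := ha A hA hAF
        exact ⟨k.castSucc, Fin.castSucc_lt_last k, v, by simpa using hv, by simpa using hAv⟩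
      | cast i =>
        obtain ⟨k, hk, v, hv, hkv⟩ := hcol i j (Fin.castSucc_lt_castSucc_iff.1 hij)
        exact ⟨k.castSucc, Fin.castSucc_lt_castSucc_iff.2 hk, v, by simpa using hv,
          by simpa using hkv⟩

end SetFamilies

/-! ### Subcomplexes generated by facets, and proper chains -/

section Facets

variable {V : Type*}

theorem IsFacet.eq_of_subset {Γ : PreAbstractSimplicialComplex V} {F G : Finset V}
    (hF : IsFacet Γ F) (hG : IsFacet Γ G) (h : F ⊆ G) : F = G :=
  hF.eq_of_le hG.1 h

/-- The complex whose nonempty faces are the nonempty subsets of members of `𝓖`. -/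
def generatedComplex (𝓖 : Finset (Finset V)) : PreAbstractSimplicialComplex V where
  faces := {F | F.Nonempty ∧ ∃ A ∈ 𝓖, F ⊆ A}
  isRelLowerSet_faces := by
    rintro F ⟨hF, A, hA, hFA⟩
    exact ⟨hF, fun G hGF hG => ⟨hG, A, hA, le_trans hGF hFA⟩⟩

theorem isFace_generatedComplex_iff {𝓖 : Finset (Finset V)} (h𝓖 : 𝓖.Nonempty) (F : Finset V) :
    IsFace (generatedComplex 𝓖) F ↔ ∃ A ∈ 𝓖, F ⊆ A := by
  constructor
  · rintro (rfl | h)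
    · obtain ⟨A, hA⟩ := h𝓖
      exact ⟨A, hA, Finset.empty_subset A⟩
    · exact h.2
  · intro h
    rcases F.eq_empty_or_nonempty with hF | hF
    · exact Or.inl hF
    · exact Or.inr ⟨hF, h⟩

/-- Facets of `Δ` are pairwise incomparable, so each member of `𝓖` stays maximal. For empty `𝓖` the
empty face would be an extra facet. -/
theorem isFacet_generatedComplex_iff {Δ : PreAbstractSimplicialComplex V}
    {𝓖 : Finset (Finset V)} (h𝓖 : 𝓖.Nonempty) (hΔ : ∀ A ∈ 𝓖, IsFacet Δ A) (F : Finset V) :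
    IsFacet (generatedComplex 𝓖) F ↔ F ∈ 𝓖 := by
  constructor
  · intro hF
    obtain ⟨A, hA, hFA⟩ := (isFace_generatedComplex_iff h𝓖 F).1 hF.1
    rwa [hF.eq_of_le ((isFace_generatedComplex_iff h𝓖 A).2 ⟨A, hA, subset_rfl⟩) hFA]
  · intro hF
    refine ⟨(isFace_generatedComplex_iff h𝓖 F).2 ⟨F, hF, subset_rfl⟩, fun B hB hFB => ?_⟩
    obtain ⟨A, hA, hBA⟩ := (isFace_generatedComplex_iff h𝓖 B).1 hB
    rwa [(hΔ F hF).eq_of_subset (hΔ A hA) (le_trans hFB hBA)]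

theorem IsTree.hasLeaves [DecidableEq V] {Δ : PreAbstractSimplicialComplex V} (hΔ : IsTree Δ) :
    HasLeaves {F | IsFacet Δ F} := by
  intro 𝓖 hsub hne
  have hiff := isFacet_generatedComplex_iff hne hsub
  obtain ⟨F, hF, hleaf⟩ := hΔ.2 (generatedComplex 𝓖) fun F hF => hsub ((hiff F).1 hF)
  simp only [hiff] at hF hleaf
  exact ⟨F, hF, hleaf⟩

/-- Distinct consecutive facets on the path share `q - 1` vertices, which is nonzero exactly because
`2 ≤ q`; stationary steps are skipped. -/
theorem IsLinearlyConnected.exists_isProperChainBetween [DecidableEq V]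
    {Δ : PreAbstractSimplicialComplex V} {q : ℕ} (hq : 2 ≤ q)
    (hcard : ∀ F, IsFacet Δ F → F.card = q) {U F G : Finset V} (hF : IsFacet Δ F)
    (h : Relation.ReflTransGen (FamilyStep {F | IsFacet Δ F} q U) F G) :
    ∃ n c, IsProperChainBetween Δ F G n c := by
  induction h with
  | refl => exact ⟨0, fun _ => F, ⟨rfl, rfl, fun _ _ => hF, by simp⟩, by simp⟩
  | @tail A B _ hAB ih =>
    obtain ⟨n, c, ⟨h0, hn, hfac, hint⟩, hdim⟩ := ih
    have hA : IsFacet Δ A := hn ▸ hfac n le_rfl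
    have hB : IsFacet Δ B := hAB.1
    by_cases heq : A = B
    · subst heq
      exact ⟨n, c, ⟨h0, hn, hfac, hint⟩, hdim⟩
    have h1 := card_sdiff_eq_one (hcard A hA) (hcard B hB) heq hAB.2.2
    have h2 := Finset.card_sdiff_add_card_inter A B
    rw [h1, hcard A hA] at h2
    let c' : ℕ → Finset V := fun i => if i ≤ n then c i else B
    have hc : ∀ i ≤ n, c' i = c i := fun i hi => if_pos hi
    have hc' : c' (n + 1) = B := if_neg (by omega)
    refine ⟨n + 1, c', ⟨?_, hc', fun i hi => ?_, fun i hi => ?_⟩, fun i hi => ?_⟩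
    · rw [hc 0 (Nat.zero_le n), h0]
    · rcases Nat.le_succ_iff.1 hi with h | rfl
      · rw [hc i h]; exact hfac i h
      · rw [hc']; exact hB
    · rcases Nat.lt_succ_iff_lt_or_eq.1 hi with h | rfl
      · rw [hc i h.le, hc (i + 1) h]; exact hint i h
      · rw [hc i le_rfl, hc', hn, ← Finset.card_pos]; omega
    · rcases Nat.lt_succ_iff_lt_or_eq.1 hi with h | rfl
      · rw [hc i h.le, hc (i + 1) h]; exact hdim i h
      · rw [hc i le_rfl, hc', hn, dim, dim, hcard B hB]; omega

theorem IsChainBetween.eq_of_card_le_one [DecidableEq V] {Δ : PreAbstractSimplicialComplex V}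
    (hcard : ∀ F, IsFacet Δ F → F.card ≤ 1) {F G : Finset V} {n : ℕ} {c : ℕ → Finset V}
    (h : IsChainBetween Δ F G n c) : F = G := by
  obtain ⟨h0, hn, hfac, hint⟩ := h
  have key : ∀ i ≤ n, c i = F := by
    intro i
    induction i with
    | zero => exact fun _ => h0
    | succ i ih =>
      intro hi
      rw [← ih (by omega)]
      obtain ⟨v, hv⟩ := hint i hi
      rw [Finset.mem_inter] at hv
      have hfi := hcard _ (hfac i (by omega))
      have hfi' := hcard _ (hfac (i + 1) hi)
      rw [Finset.card_le_one] at hfi hfi'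
      ext w
      exact ⟨fun hw => hfi' w hw v hv.2 ▸ hv.1, fun hw => hfi w hw v hv.1 ▸ hv.2⟩
  rw [← hn, key n le_rfl]

theorem IsLinearlyConnected.isPure_and_isConnectedInCodimOne [DecidableEq V]
    {Δ : PreAbstractSimplicialComplex V} {q : ℕ}
    (h : IsLinearlyConnected {F | IsFacet Δ F} q) (hΔ : IsConnected Δ) :
    IsPure Δ ∧ IsConnectedInCodimOne Δ := by
  refine ⟨fun F G hF hG => by rw [dim, dim, h.1 F hF, h.1 G hG], fun F G hF hG _ => ?_⟩
  by_cases hq : 2 ≤ q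
  · exact exists_isProperChainBetween hq h.1 hF (h.2 F hF G hG)
  -- For `q ≤ 1` consecutive facets of a path may be disjoint. Connectedness is used instead: facets
  -- with at most one vertex that meet are equal, so `F = G`.
  · obtain ⟨n, c, hc⟩ := hΔ F G hF hG
    obtain rfl := hc.eq_of_card_le_one fun F hF => by
      have := h.1 F hF
      omega
    exact ⟨0, fun _ => F, ⟨rfl, rfl, fun _ _ => hF, by simp⟩, by simp⟩

end Facets

/-! ### Translation between facets and square-free monomials -/

section FacetIdeals

variable {V : Type*} {K : Type*} [Field K]

/-- The exponent of the square-free monomial with support `F`. -/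
noncomputable def exponent (F : Finset V) : V →₀ ℕ :=
  ∑ v ∈ F, Finsupp.single v 1

theorem exponent_apply [DecidableEq V] (F : Finset V) (v : V) :
    exponent F v = if v ∈ F then 1 else 0 := by
  simp [exponent, Finsupp.finsetSum_apply, Finsupp.single_apply]

theorem degree_exponent (F : Finset V) : (exponent F).degree = F.card := by
  simp [exponent, map_sum]

theorem exponent_le_iff {F : Finset V} {m : V →₀ ℕ} :
    exponent F ≤ m ↔ ∀ v ∈ F, m v ≠ 0 := by
  classical
  refine ⟨fun h v hv => ?_, fun h v => ?_⟩
  · have := h v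
    rw [exponent_apply, if_pos hv] at this
    omega
  · rw [exponent_apply]
    split_ifs with hv
    · exact Nat.one_le_iff_ne_zero.2 (h v hv)
    · exact Nat.zero_le _

theorem exponent_le_exponent_iff {F G : Finset V} : exponent F ≤ exponent G ↔ F ⊆ G := by
  classical
  rw [exponent_le_iff]
  simp [exponent_apply, Finset.subset_iff]

theorem exponent_injective : Function.Injective (exponent : Finset V → V →₀ ℕ) := fun _ _ h =>
  subset_antisymm (exponent_le_exponent_iff.1 h.le) (exponent_le_exponent_iff.1 h.ge)

theorem exponent_sup_exponent [DecidableEq V] (F G : Finset V) :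
    exponent F ⊔ exponent G = exponent (F ∪ G) := by
  ext v
  rw [Finsupp.sup_apply]
  simp only [exponent_apply, Finset.mem_union]
  by_cases hF : v ∈ F <;> by_cases hG : v ∈ G <;> simp [hF, hG]

theorem prod_X_eq_monomial_exponent (F : Finset V) :
    ∏ v ∈ F, (X v : MvPolynomial V K) = monomial (exponent F) 1 := by
  rw [exponent, monomial_sum_one]
  rfl

variable {Δ : PreAbstractSimplicialComplex V}

theorem facetIdeal_eq_span_monomial : facetIdeal K Δ =
    Ideal.span ((fun a => monomial a (1 : K)) '' (exponent '' {F | IsFacet Δ F})) := by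
  rw [facetIdeal, Set.image_image]
  congr 1
  ext p
  simp only [prod_X_eq_monomial_exponent, Set.mem_ofPred_eq, Set.mem_image, eq_comm]

theorem isMonomialIdeal_facetIdeal : IsMonomialIdeal (facetIdeal K Δ) :=
  ⟨_, facetIdeal_eq_span_monomial⟩

theorem monomial_mem_facetIdeal_iff {m : V →₀ ℕ} :
    monomial m (1 : K) ∈ facetIdeal K Δ ↔ ∃ F, IsFacet Δ F ∧ exponent F ≤ m := by
  classical
  rw [facetIdeal_eq_span_monomial, mem_ideal_span_monomial_image]
  simp [support_monomial]

theorem minGens_facetIdeal : minGens (facetIdeal K Δ) = exponent '' {F | IsFacet Δ F} := by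
  ext a
  constructor
  · intro ha
    obtain ⟨F, hF, hFa⟩ := monomial_mem_facetIdeal_iff.1 ha.1
    refine ⟨F, hF, le_antisymm hFa (ha.2 ?_ hFa)⟩
    exact monomial_mem_facetIdeal_iff.2 ⟨F, hF, le_rfl⟩
  · rintro ⟨F, hF, rfl⟩
    refine ⟨monomial_mem_facetIdeal_iff.2 ⟨F, hF, le_rfl⟩, fun b hb hbF => ?_⟩
    obtain ⟨G, hG, hGb⟩ := monomial_mem_facetIdeal_iff.1 hb
    rwa [← hG.eq_of_subset hF (exponent_le_exponent_iff.1 (hGb.trans hbF))]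

theorem isLinearlyConnected_of_hasLinearResolution [DecidableEq V]
    (h : HasLinearResolution (facetIdeal K Δ)) :
    ∃ q, IsLinearlyConnected {F | IsFacet Δ F} q := by
  obtain ⟨q, hdeg, hchain⟩ := h.exists_reflTransGen_linearStep isMonomialIdeal_facetIdeal
  rw [minGens_facetIdeal] at hdeg hchain
  have hcard : ∀ F, IsFacet Δ F → F.card = q := fun F hF => by
    rw [← degree_exponent]; exact hdeg _ ⟨F, hF, rfl⟩
  refine ⟨q, hcard, fun F hF G hG => ?_⟩
  have key : ∀ d, Relation.ReflTransGen
      (LinearStep (facetIdeal K Δ) q (exponent F ⊔ exponent G)) (exponent F) d →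
      ∃ D, exponent D = d ∧
        Relation.ReflTransGen (FamilyStep {F | IsFacet Δ F} q (F ∪ G)) F D := by
    intro d hd
    induction hd with
    | refl => exact ⟨F, rfl, Relation.ReflTransGen.refl⟩
    | @tail b d _ hbd ih =>
      obtain ⟨B, rfl, hB⟩ := ih
      obtain ⟨hdI, hddeg, hdU, hcup⟩ := hbd
      obtain ⟨D, hD, hDd⟩ := monomial_mem_facetIdeal_iff.1 hdI
      -- A facet monomial dividing `d` has the same degree `q`, so the path never leaves the facet
      -- monomials.
      have hDd' : exponent D = d := by
        obtain ⟨e, rfl⟩ := exists_add_of_le hDd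
        rw [map_add, degree_exponent, hcard D hD] at hddeg
        rw [(Finsupp.degree_eq_zero_iff e).1 (by omega), add_zero]
      subst hDd'
      rw [exponent_sup_exponent, exponent_le_exponent_iff] at hdU
      rw [exponent_sup_exponent, degree_exponent] at hcup
      exact ⟨D, rfl, hB.tail ⟨hD, hdU, hcup⟩⟩
  obtain ⟨D, hDG, hD⟩ := key _ (hchain _ ⟨F, hF, rfl⟩ _ ⟨G, hG, rfl⟩)
  rwa [exponent_injective hDG] at hD

theorem IsLinearlyConnected.isLinearQuotientIdeal [Finite V] [DecidableEq V] {q : ℕ}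
    (h : IsLinearlyConnected {F | IsFacet Δ F} q) (hleaf : HasLeaves {F | IsFacet Δ F}) :
    IsLinearQuotientIdeal (facetIdeal K Δ) := by
  have hfin : {F | IsFacet Δ F}.Finite := Set.toFinite _
  obtain ⟨m, a, hinj, hrange, hcol⟩ := exists_linearQuotient_order hfin.toFinset
    (q := q) (by rwa [hfin.coe_toFinset]) (by rwa [hfin.coe_toFinset])
  rw [hfin.coe_toFinset] at hrange
  refine ⟨isMonomialIdeal_facetIdeal, m, exponent ∘ a, exponent_injective.comp hinj, ?_,
    fun i => ⟨{v | ∃ k < i, a k \ a i = {v}}, ?_⟩, fun i j => ?_⟩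
  · rw [Set.range_comp, hrange, minGens_facetIdeal]
  · have hseg : initialSegmentIdeal K (exponent ∘ a) i =
        Ideal.span ((fun b => monomial b (1 : K)) '' ((exponent ∘ a) '' Set.Iio i)) := by
      rw [initialSegmentIdeal, Set.image_image]
      congr 1
      ext p
      simp only [Set.mem_ofPred_eq, Set.mem_image, Set.mem_Iio, eq_comm]
    ext p
    rw [Submodule.mem_colon_singleton, hseg, smul_eq_mul, mem_ideal_span_monomial_image,
      mem_ideal_span_X_image]
    constructor
    · intro hp n hn
      obtain ⟨_, ⟨j, hj, rfl⟩, hle⟩ := hp (n + exponent (a i)) (by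
        rw [mem_support_iff, Function.comp_apply, coeff_mul_monomial, mul_one]
        exact mem_support_iff.1 hn)
      -- The vertex `v` of `a j` is missing from `a i`, so the corresponding variable must divide
      -- `n`.
      obtain ⟨k, hk, v, hv, hkv⟩ := hcol i j hj
      rw [Finset.mem_sdiff] at hv
      refine ⟨v, ⟨k, hk, hkv⟩, ?_⟩
      have := exponent_le_iff.1 hle v hv.1
      rwa [Finsupp.add_apply, exponent_apply, if_neg hv.2, add_zero] at this
    · intro hp n hn
      have hn' := hn
      rw [mem_support_iff, Function.comp_apply, coeff_mul_monomial'] at hn'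
      split_ifs at hn' with hle
      · obtain ⟨v, ⟨k, hk, hkv⟩, hv⟩ := hp _ (mem_support_iff.2 (by simpa using hn'))
        -- The monomial of `a k` divides `n`: its vertices in `a i` are supplied by that factor, and
        -- the only other one, `v`, divides the quotient.
        refine ⟨_, ⟨k, hk, rfl⟩, exponent_le_iff.2 fun w hw => ?_⟩
        by_cases hwi : w ∈ a i
        · exact exponent_le_iff.1 hle w hwi
        · have : w ∈ a k \ a i := Finset.mem_sdiff.2 ⟨hw, hwi⟩
          rw [hkv, Finset.mem_singleton] at this
          subst this
          rw [Finsupp.tsub_apply] at hv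
          omega
      · exact absurd rfl hn'
  · have hdeg : ∀ i, (exponent (a i)).degree = q := fun i => by
      rw [degree_exponent]
      exact h.1 _ (hrange ▸ Set.mem_range_self i)
    rw [Function.comp_apply, Function.comp_apply, hdeg, hdeg]

end FacetIdeals

end FacetComplex

/-! ### The proposition -/

theorem proposition3p8 {V : Type*} [Fintype V] [DecidableEq V] (K : Type*) [Field K]
    (Δ : AbstractSimplicialComplex V)
    (hΔ : FacetComplex.IsTree Δ.toPreAbstractSimplicialComplex) :
    (FacetComplex.IsLinearQuotientTree K Δ.toPreAbstractSimplicialComplex ↔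
      FacetComplex.IsLinearTree K Δ.toPreAbstractSimplicialComplex) ∧
    (FacetComplex.IsLinearQuotientTree K Δ.toPreAbstractSimplicialComplex ∨
        FacetComplex.IsLinearTree K Δ.toPreAbstractSimplicialComplex →
      FacetComplex.IsPure Δ.toPreAbstractSimplicialComplex ∧
        FacetComplex.IsConnectedInCodimOne Δ.toPreAbstractSimplicialComplex) := by
  have himp : FacetComplex.IsLinearQuotientTree K Δ.toPreAbstractSimplicialComplex →
      FacetComplex.IsLinearTree K Δ.toPreAbstractSimplicialComplex :=
    fun h => ⟨hΔ, h.2.hasLinearResolution⟩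
  refine ⟨⟨himp, fun h => ⟨hΔ, ?_⟩⟩, fun h => ?_⟩
  · obtain ⟨q, hq⟩ := FacetComplex.isLinearlyConnected_of_hasLinearResolution h.2
    exact hq.isLinearQuotientIdeal hΔ.hasLeaves
  · obtain ⟨q, hq⟩ := FacetComplex.isLinearlyConnected_of_hasLinearResolution (h.elim himp id).2
    exact hq.isPure_and_isConnectedInCodimOne hΔ.1
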